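/- A three-step path consists of up-steps $(1,1)$, level steps $(1,0)$ and down-steps $(1,-1)$. For non-negative integers $m$ and $k$ let $MP_m(k)$ (the generalised Motzkin prefix number) be the number of three-step paths with $m$ steps that start at $(0,k)$ and never run below the $x$-axis, with arbitrary end point. Let $\binom{n}{a,b}=\frac{n!}{a!\,b!\,(n-a-b)!}$ denote the trinomial coefficient, read as $0$ if one of $a$, $b$, $n-a-b$ is negative. Then, for all positive integers $n$ and non-negative integers $k$, $$\det_{0\le i,j\le n-1}\bigl(MP_{i+j}(k)\bigr)=\det_{0\le i,j\le n-1}\Biggl(\sum_{\ell\ge0}\sum_{l=-k}^{k+1}\binom{i+j}{\ell,\ell+l}\Biggr)=\begin{cases}(-1)^{n_1\binom{k+1}{2}},&\text{if } n=(k+1)n_1,\\ (-1)^{n_1\binom{k+1}{2}},&\text{if } n=(k+1)n_1+1,\\ 0,&\text{if } n\not\equiv 0,1 \pmod{k+1},\end{cases}$$ where $n_1$ denotes a non-negative integer. In particular, for $k=0$, the Hankel determinant $\det_{0\le i,j\le n-1}(MP_{i+j}(0))$ of the Motzkin prefix numbers equals $1$ for every positive integer $n$. -/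

import Mathlib

/-- The height, after the first `j` steps, of the three-step path which starts at height `k` and
whose `i`-th step is the up-step `(1,1)`, the level step `(1,0)` or the down-step `(1,-1)`,
according to whether `s i` is `1`, `0` or `-1`. -/
def pathHeight (k : ℕ) {m : ℕ} (s : Fin m → SignType) (j : ℕ) : ℤ :=
  (k : ℤ) + ∑ i : Fin m, if (i : ℕ) < j then (s i : ℤ) else 0

/-- The generalised Motzkin prefix number `MP_m(k)`: the number of three-step paths with `m` steps
which start at height `k` and never run below the `x`-axis, with arbitrary end point. -/
def motzkinPrefix (m k : ℕ) : ℕ :=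
  Fintype.card {s : Fin m → SignType // ∀ j ≤ m, 0 ≤ pathHeight k s j}

/-- The trinomial coefficient `n! / (a! b! (n - a - b)!)`, which is zero if one of
`a`, `b`, `n - a - b` is negative. -/
def trinomial (n : ℕ) (a b : ℤ) : ℕ :=
  if 0 ≤ a ∧ 0 ≤ b ∧ a + b ≤ n then
    n.factorial / (a.toNat.factorial * b.toNat.factorial * ((n : ℤ) - a - b).toNat.factorial)
  else 0

/-- The sum of the trinomial coefficients of `m` with lower entries `ℓ` and `ℓ + l`, over all
`ℓ ≥ 0` and all `l` with `-k ≤ l ≤ k + 1`. The terms with `ℓ > m` vanish. -/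
noncomputable def trinomialSum (m k : ℕ) : ℕ :=
  ∑ ℓ ∈ Finset.range (m + 1), ∑ l ∈ Finset.Icc (-(k : ℤ)) ((k : ℤ) + 1),
    trinomial m (ℓ : ℤ) ((ℓ : ℤ) + l)

/-!
With `z` marking the height, the steps are recorded by `z + 1 + z⁻¹`. Conditioning on the first step
gives a recurrence for `MP_m(k)`, which is also satisfied by the sum of the coefficients of `z ^ l`
in `(z + 1 + z⁻¹) ^ m` over `-k ≤ l ≤ k + 1`, so that the two agree. Hence, with `K = k + 1`, the
Hankel matrix is the Gram matrix, in the basis of monomials, of the linear functional which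
evaluates a polynomial at `z + 1 + z⁻¹` and sums the coefficients in this window. Its determinant
does not change in another basis of monic polynomials.

Choose a basis of Chebyshev type. Multiplication by `(z^(K(a+1)) + z^(-Ka)) / (z^K + 1)` collapses
the window sum to coefficients of index at least `Ka` in absolute value, and multiplication by
`(z - 1)(1 - z⁻¹)(z^(K(a+1)) - z^(-K(a+1))) / (z^K - z^(-K))` collapses it to coefficients near
`K(a+1)`. Hence the Gram matrix is block triangular. Its diagonal blocks are alternately `(1)` and a
`k × k` antitriangular matrix with `-1` on the antidiagonal, which has determinant
`(-1)^(k(k-1)/2 + k)`. A size which cuts properly into one of the latter leaves a zero row.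
-/

open Finset Matrix
open Polynomial hiding trinomial
open LaurentPolynomial (T)
open scoped LaurentPolynomial

section Determinants

variable {R : Type*} [CommRing R]

theorem det_eq_mul_of_lower_left_eq_zero {m r : ℕ} (M : Matrix (Fin (m + r)) (Fin (m + r)) R)
    (h : ∀ i j, M (Fin.natAdd m i) (Fin.castAdd r j) = 0) :
    M.det = (M.submatrix (Fin.castAdd r) (Fin.castAdd r)).det *
      (M.submatrix (Fin.natAdd m) (Fin.natAdd m)).det := by
  rw [← det_reindex_self finSumFinEquiv.symm, ← det_fromBlocks_zero₂₁ _
    (M.submatrix (Fin.castAdd r) (Fin.natAdd m))]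
  congr 1
  ext (i | i) (j | j) <;> simp [h]

theorem det_of_antitriangular {r : ℕ} (M : Matrix (Fin r) (Fin r) R)
    (h : ∀ i j, j < i.rev → M i j = 0) :
    M.det = (-1) ^ r.choose 2 * ∏ i, M i i.rev := by
  induction r with
  | zero => simp
  | succ r ih =>
    rw [det_succ_row_zero, sum_eq_single_of_mem (Fin.last r) (mem_univ _), Fin.succAbove_last,
      ih (M.submatrix Fin.succ Fin.castSucc) fun i j hij =>
        h _ _ (by simpa [Fin.rev_succ] using hij),
      Fin.prod_univ_succ, Nat.choose_succ_succ' r 1, Nat.choose_one_right, pow_add]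
    · simp only [submatrix_apply, Fin.val_last, Fin.rev_zero, Fin.rev_succ]
      ring
    · intro j _ hj
      rw [h 0 j (by simpa using Fin.lt_last_iff_ne_last.2 hj), mul_zero, zero_mul]

theorem det_gram_of_isMonicOfDegree [Nontrivial R] (φ : R[X] →ₗ[R] R) {b : ℕ → R[X]}
    (hb : ∀ i, IsMonicOfDegree (b i) i) (n : ℕ) :
    (of fun i j : Fin n => φ (b i * b j)).det =
      (of fun i j : Fin n => φ (X ^ ((i : ℕ) + (j : ℕ)))).det := by
  set P : Matrix (Fin n) (Fin n) R := of fun s i => (b i).coeff s with hP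
  have hdet : P.det = 1 :=
    det_matrixOfPolynomials (fun i : Fin n => b i) (fun i => (hb i).natDegree_eq)
      fun i => (hb i).monic
  have hsum : ∀ i : Fin n, b i = ∑ s : Fin n, P s i • X ^ (s : ℕ) := fun i => by
    conv_lhs =>
      rw [(b i).as_sum_range_C_mul_X_pow' (n := n) (by rw [(hb i).natDegree_eq]; exact i.2)]
    simp only [sum_range, smul_eq_C_mul, hP, of_apply]
  have hmul : (of fun i j : Fin n => φ (b i * b j)) =
      Pᵀ * (of fun i j : Fin n => φ (X ^ ((i : ℕ) + (j : ℕ)))) * P := by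
    ext i j
    rw [of_apply, hsum i, hsum j, sum_mul_sum, sum_comm]
    simp only [smul_mul_smul_comm, ← pow_add, map_sum, map_smul, smul_eq_mul, mul_apply, sum_mul,
      transpose_apply, of_apply]
    exact sum_congr rfl fun s _ => sum_congr rfl fun t _ => by ring
  rw [hmul, det_mul, det_mul, det_transpose, hdet, one_mul, mul_one]

end Determinants

section Paths

theorem pathHeight_zero (k : ℕ) {m : ℕ} (s : Fin m → SignType) : pathHeight k s 0 = k := by
  simp only [pathHeight, Nat.not_lt_zero, if_false, sum_const_zero, add_zero]

theorem pathHeight_cons_succ (k : ℕ) {m : ℕ} (e : SignType) (s : Fin m → SignType) (j : ℕ) :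
    pathHeight k (Fin.cons e s : Fin (m + 1) → SignType) (j + 1) = pathHeight k s j + e := by
  simp only [pathHeight, Fin.sum_univ_succ, Fin.val_zero, Fin.cons_zero, Fin.cons_succ,
    Fin.val_succ, Nat.succ_pos, if_true, add_lt_add_iff_right]
  ring

theorem pathHeight_succ_start (k : ℕ) {m : ℕ} (s : Fin m → SignType) (j : ℕ) :
    pathHeight (k + 1) s j = pathHeight k s j + 1 := by
  simp only [pathHeight, Nat.cast_succ, add_right_comm]

theorem forall_pathHeight_cons_nonneg (k : ℕ) {m : ℕ} (e : SignType) (s : Fin m → SignType) :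
    (∀ j ≤ m + 1, 0 ≤ pathHeight k (Fin.cons e s : Fin (m + 1) → SignType) j) ↔
      ∀ j ≤ m, 0 ≤ pathHeight k s j + e := by
  simp only [← pathHeight_cons_succ]
  refine ⟨fun h j hj => h _ (by omega), ?_⟩
  rintro h (_ | j) hj
  · rw [pathHeight_zero]
    positivity
  · exact h j (by omega)

theorem motzkinPrefix_eq_natCard (m k : ℕ) :
    motzkinPrefix m k = Nat.card {s : Fin m → SignType // ∀ j ≤ m, 0 ≤ pathHeight k s j} := by
  rw [motzkinPrefix, Nat.card_eq_fintype_card]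

theorem motzkinPrefix_zero (k : ℕ) : motzkinPrefix 0 k = 1 := by
  rw [motzkinPrefix_eq_natCard, Nat.card_eq_one_iff_unique]
  refine ⟨inferInstance, ⟨⟨Fin.elim0, fun j hj => ?_⟩⟩⟩
  rw [Nat.le_zero.1 hj, pathHeight_zero]
  positivity

theorem motzkinPrefix_succ_eq_sum (m k : ℕ) :
    motzkinPrefix (m + 1) k =
      Nat.card {s : Fin m → SignType // ∀ j ≤ m, 0 ≤ pathHeight k s j} +
      Nat.card {s : Fin m → SignType // ∀ j ≤ m, 0 ≤ pathHeight k s j - 1} +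
      Nat.card {s : Fin m → SignType // ∀ j ≤ m, 0 ≤ pathHeight k s j + 1} := by
  have firstStep : {s : Fin (m + 1) → SignType // ∀ j ≤ m + 1, 0 ≤ pathHeight k s j} ≃
      Σ e : SignType, {s : Fin m → SignType // ∀ j ≤ m, 0 ≤ pathHeight k s j + e} :=
    ((Fin.consEquiv fun _ => SignType).subtypeEquiv fun p =>
      (forall_pathHeight_cons_nonneg k p.1 p.2).symm).symm.trans
        (Equiv.subtypeProdEquivSigmaSubtype fun (e : SignType) s =>
          ∀ j ≤ m, 0 ≤ pathHeight k s j + e)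
  rw [motzkinPrefix_eq_natCard, Nat.card_congr firstStep, Nat.card_sigma, SignType.univ_eq,
    sum_insert (by decide), sum_insert (by decide), sum_singleton, ← add_assoc]
  simp only [SignType.coe_zero, SignType.coe_one, SignType.coe_neg, add_zero, ← sub_eq_add_neg]

theorem motzkinPrefix_succ_succ (m k : ℕ) :
    motzkinPrefix (m + 1) (k + 1) =
      motzkinPrefix m (k + 1) + motzkinPrefix m k + motzkinPrefix m (k + 2) := by
  simp only [motzkinPrefix_succ_eq_sum, motzkinPrefix_eq_natCard, pathHeight_succ_start,
    add_sub_cancel_right]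

theorem motzkinPrefix_succ_zero (m : ℕ) :
    motzkinPrefix (m + 1) 0 = motzkinPrefix m 0 + motzkinPrefix m 1 := by
  have : IsEmpty {s : Fin m → SignType // ∀ j ≤ m, 0 ≤ pathHeight 0 s j - 1} :=
    ⟨fun s => by simpa [pathHeight_zero] using s.2 0 (Nat.zero_le m)⟩
  simp only [motzkinPrefix_succ_eq_sum, motzkinPrefix_eq_natCard, pathHeight_succ_start,
    Nat.card_of_isEmpty, add_zero]

end Paths

section StepEvaluation

variable (R : Type*) [CommRing R]

/-- The generating function `z + 1 + z⁻¹` of the three steps, with `z = T 1`. -/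
noncomputable def stepSum : R[T;T⁻¹] := T 1 + 1 + T (-1)

variable {R}

/-- Evaluation of a polynomial at `z + 1 + z⁻¹`. Via this map the Hankel matrix of path numbers
becomes the Gram matrix of the functional `windowSum`. -/
noncomputable def stepEval : R[X] →ₐ[R] R[T;T⁻¹] := aeval (stepSum R)

/-- The sum of the coefficients of `z ^ l` over the window `-K < l ≤ K`. For `K = k + 1` this turns
`(z + 1 + z⁻¹) ^ m` into `MP_m(k)`. The coefficients of index `t + 1` and `-t` are paired, so that
the window grows by one coefficient on each side. -/
noncomputable def windowSum (K : ℕ) : R[T;T⁻¹] →ₗ[R] R where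
  toFun f := ∑ t ∈ range K, (f.coeff (t + 1) + f.coeff (-t))
  map_add' f g := by
    simp only [AddMonoidAlgebra.coeff_add, Finsupp.add_apply, ← sum_add_distrib]
    exact sum_congr rfl fun t _ => by ring
  map_smul' c f := by
    simp only [AddMonoidAlgebra.coeff_smul, Finsupp.smul_apply, RingHom.id_apply, smul_sum,
      smul_add]

theorem windowSum_apply (K : ℕ) (f : R[T;T⁻¹]) :
    windowSum K f = ∑ t ∈ range K, (f.coeff (t + 1) + f.coeff (-t)) := rfl

theorem windowSum_zero (f : R[T;T⁻¹]) : windowSum 0 f = 0 := rfl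

theorem windowSum_succ (K : ℕ) (f : R[T;T⁻¹]) :
    windowSum (K + 1) f = windowSum K f + (f.coeff (K + 1) + f.coeff (-K)) :=
  sum_range_succ _ _

theorem windowSum_eq_sum_Icc (k : ℕ) (f : R[T;T⁻¹]) :
    windowSum (k + 1) f = ∑ l ∈ Icc (-(k : ℤ)) (k + 1), f.coeff l := by
  induction k with
  | zero =>
    rw [windowSum_succ, windowSum_zero, zero_add, add_comm,
      show Icc (-((0 : ℕ) : ℤ)) ((0 : ℕ) + 1) = {0, 1} from rfl, sum_pair zero_ne_one]
    rfl
  | succ k ih =>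
    have hIcc : Icc (-((k + 1 : ℕ) : ℤ)) ((k + 1 : ℕ) + 1) =
        insert (((k + 1 : ℕ) : ℤ) + 1) (insert (-((k + 1 : ℕ) : ℤ)) (Icc (-(k : ℤ)) (k + 1))) := by
      ext l
      simp only [mem_Icc, mem_insert]
      omega
    rw [hIcc, sum_insert (by simp only [mem_Icc, mem_insert]; omega),
      sum_insert (by simp only [mem_Icc]; omega), windowSum_succ, ih]
    ring

theorem coeff_T_mul (f : R[T;T⁻¹]) (n l : ℤ) : (T n * f).coeff l = f.coeff (l - n) := by
  rw [LaurentPolynomial.T_mul, LaurentPolynomial.T, AddMonoidAlgebra.coeff_mul_single_apply,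
    mul_one, sub_eq_add_neg]

theorem coeff_one_laurentPolynomial (l : ℤ) : (1 : R[T;T⁻¹]).coeff l = if l = 0 then 1 else 0 := by
  rw [← LaurentPolynomial.T_zero, LaurentPolynomial.T_apply]
  simp only [eq_comm]

theorem coeff_stepSum_mul (f : R[T;T⁻¹]) (l : ℤ) :
    (stepSum R * f).coeff l = f.coeff (l - 1) + f.coeff l + f.coeff (l + 1) := by
  simp only [stepSum, add_mul, one_mul, AddMonoidAlgebra.coeff_add, Finsupp.add_apply, coeff_T_mul,
    sub_neg_eq_add]

theorem windowSum_succ_stepSum_mul (K : ℕ) (f : R[T;T⁻¹]) :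
    windowSum (K + 1) (stepSum R * f) =
      windowSum (K + 1) f + windowSum K f + windowSum (K + 2) f := by
  induction K with
  | zero =>
    simp only [windowSum_succ, windowSum_zero, coeff_stepSum_mul]
    push_cast
    ring_nf
  | succ K ih =>
    rw [windowSum_succ, ih]
    simp only [windowSum_succ, coeff_stepSum_mul]
    push_cast
    ring_nf

theorem windowSum_T_one_sub_one_mul (K : ℕ) (f : R[T;T⁻¹]) :
    windowSum K ((T 1 - 1) * f) = ((T K - T (-K)) * f).coeff 0 := by
  simp only [sub_mul, one_mul, AddMonoidAlgebra.coeff_sub, Finsupp.sub_apply, coeff_T_mul,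
    zero_sub, neg_neg]
  induction K with
  | zero => simp [windowSum_zero]
  | succ K ih =>
    rw [windowSum_succ, ih]
    simp only [AddMonoidAlgebra.coeff_sub, Finsupp.sub_apply, coeff_T_mul]
    push_cast
    ring_nf

theorem windowSum_eq_sum_coeff_one_add_T_mul (K : ℕ) (f : R[T;T⁻¹]) :
    windowSum K f = ∑ t ∈ range K, ((1 + T K) * f).coeff (t + 1) := by
  simp only [windowSum_apply, add_mul, one_mul, AddMonoidAlgebra.coeff_add, Finsupp.add_apply,
    coeff_T_mul, sum_add_distrib]
  congr 1
  rw [← sum_range_reflect]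
  refine sum_congr rfl fun t ht => congrArg _ ?_
  have := mem_range.1 ht
  omega

theorem motzkinPrefix_eq_windowSum (m k : ℕ) :
    (motzkinPrefix m k : R) = windowSum (k + 1) (stepSum R ^ m) := by
  induction m generalizing k with
  | zero =>
    rw [motzkinPrefix_zero, pow_zero, windowSum_eq_sum_Icc]
    simp only [coeff_one_laurentPolynomial]
    rw [sum_ite_eq', if_pos (by simp only [mem_Icc]; omega), Nat.cast_one]
  | succ m ih =>
    rw [pow_succ', windowSum_succ_stepSum_mul]
    rcases k with _ | k
    · rw [motzkinPrefix_succ_zero, Nat.cast_add, ih, ih, windowSum_zero, add_zero]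
    · rw [motzkinPrefix_succ_succ, Nat.cast_add, Nat.cast_add, ih, ih, ih]

theorem trinomial_add_left (a p b : ℕ) :
    trinomial (a + p) a b = (a + p).choose a * p.choose b := by
  by_cases h : b ≤ p
  · obtain ⟨c, rfl⟩ := Nat.exists_eq_add_of_le h
    have hc : (((a + (b + c) : ℕ) : ℤ) - a - b).toNat = c := by omega
    rw [trinomial, if_pos ⟨by positivity, by positivity, by omega⟩, hc, Int.toNat_natCast,
      Int.toNat_natCast]
    refine Nat.div_eq_of_eq_mul_left (by positivity) ?_
    rw [← Nat.add_choose_mul_factorial_mul_factorial a (b + c),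
      ← Nat.add_choose_mul_factorial_mul_factorial b c, Nat.choose_symm_add, Nat.choose_symm_add]
    ring
  · rw [trinomial, if_neg (by omega), Nat.choose_eq_zero_of_lt (not_le.1 h), mul_zero]

theorem coeff_one_add_T_one_pow_natCast (p b : ℕ) :
    ((1 + T 1 : R[T;T⁻¹]) ^ p).coeff b = p.choose b := by
  rw [← toLaurent_one, ← toLaurent_X, ← map_add, ← map_pow, LaurentPolynomial.coeff_toLaurent]
  exact (Finsupp.mapDomain_apply Nat.castEmbedding.injective _ b).trans (coeff_one_add_X_pow R p b)

theorem coeff_one_add_T_one_pow_of_neg (p : ℕ) {l : ℤ} (hl : l < 0) :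
    ((1 + T 1 : R[T;T⁻¹]) ^ p).coeff l = 0 := by
  rw [← toLaurent_one, ← toLaurent_X, ← map_add, ← map_pow, LaurentPolynomial.coeff_toLaurent,
    Finsupp.mapDomain_of_notMem_range]
  rintro ⟨b, rfl⟩
  exact hl.not_ge (Int.natCast_nonneg b)

theorem coeff_stepSum_pow (m : ℕ) (l : ℤ) :
    (stepSum R ^ m).coeff l = ∑ ℓ ∈ range (m + 1), (trinomial m ℓ (ℓ + l) : R) := by
  have hterm : ∀ ℓ ∈ range (m + 1),
      (T (-1) ^ ℓ * (1 + T 1) ^ (m - ℓ) * (m.choose ℓ : R[T;T⁻¹])).coeff l =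
        (trinomial m ℓ (ℓ + l) : R) := fun ℓ hℓ => by
    obtain ⟨p, rfl⟩ := Nat.exists_eq_add_of_le (mem_range_succ_iff.1 hℓ)
    rw [mul_comm, ← nsmul_eq_mul, AddMonoidAlgebra.coeff_smul, Finsupp.smul_apply,
      LaurentPolynomial.T_pow, coeff_T_mul, Nat.add_sub_cancel_left, nsmul_eq_mul,
      show l - ℓ * -1 = ℓ + l by ring]
    rcases lt_or_ge ((ℓ : ℤ) + l) 0 with hneg | hnonneg
    · rw [coeff_one_add_T_one_pow_of_neg p hneg, trinomial, if_neg (by omega), Nat.cast_zero,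
        mul_zero]
    · lift (ℓ : ℤ) + l to ℕ using hnonneg with b
      rw [coeff_one_add_T_one_pow_natCast, trinomial_add_left, Nat.cast_mul]
  rw [show stepSum R = T (-1) + (1 + T 1) by rw [stepSum]; ring, add_pow,
    AddMonoidAlgebra.coeff_sum, Finsupp.finsetSum_apply]
  exact sum_congr rfl hterm

theorem trinomialSum_eq_windowSum (m k : ℕ) :
    (trinomialSum m k : R) = windowSum (k + 1) (stepSum R ^ m) := by
  rw [windowSum_eq_sum_Icc, trinomialSum, sum_comm]
  push_cast
  simp only [coeff_stepSum_pow]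

theorem stepEval_X : stepEval (X : R[X]) = stepSum R := aeval_X _

theorem coeff_stepEval_neg (P : R[X]) (l : ℤ) : (stepEval P).coeff (-l) = (stepEval P).coeff l := by
  have hinv : (LaurentPolynomial.invert.toAlgHom.comp stepEval : R[X] →ₐ[R] R[T;T⁻¹]) =
      stepEval := by
    refine algHom_ext ?_
    change LaurentPolynomial.invert (stepEval X) = stepEval X
    simp only [stepEval_X, stepSum, map_add, map_one, LaurentPolynomial.invert_T, neg_neg]
    ring
  rw [← LaurentPolynomial.invert_apply]
  exact congrArg (fun f => AddMonoidAlgebra.coeff f l) (DFunLike.congr_fun hinv P)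

theorem coeff_stepSum_pow_of_le {m : ℕ} {l : ℤ} (h : m ≤ l) :
    (stepSum R ^ m).coeff l = if l = m then 1 else 0 := by
  induction m generalizing l with
  | zero => rw [pow_zero, coeff_one_laurentPolynomial, Nat.cast_zero]
  | succ m ih =>
    push_cast at h
    rw [pow_succ', coeff_stepSum_mul, ih (by omega), ih (by omega), ih (by omega),
      if_neg (by omega : l ≠ m), if_neg (by omega : l + 1 ≠ m), add_zero, add_zero]
    simp only [sub_eq_iff_eq_add, Nat.cast_succ]

theorem coeff_stepEval_natCast {P : R[X]} {n : ℕ} (h : P.natDegree ≤ n) :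
    (stepEval P).coeff n = P.coeff n := by
  refine induction_with_natDegree_le (fun P => (stepEval P).coeff (n : ℤ) = P.coeff n) n ?_ ?_ ?_
    P h
  · simp only [map_zero, coeff_zero, AddMonoidAlgebra.coeff_zero, Finsupp.zero_apply]
  · intro m r _ hm
    rw [← smul_eq_C_mul, map_smul, map_pow, stepEval_X, AddMonoidAlgebra.coeff_smul,
      Finsupp.smul_apply, coeff_stepSum_pow_of_le (by exact_mod_cast hm), coeff_smul, coeff_X_pow]
    simp only [Nat.cast_inj]
  · intro p q _ _ hp hq
    rw [map_add, AddMonoidAlgebra.coeff_add, Finsupp.add_apply, hp, hq, coeff_add]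

theorem coeff_stepEval {P : R[X]} {l : ℤ} (h : P.natDegree ≤ l.natAbs) :
    (stepEval P).coeff l = P.coeff l.natAbs := by
  rw [← coeff_stepEval_natCast h]
  rcases l.natAbs_eq with hl | hl
  · rw [← hl]
  · rw [← coeff_stepEval_neg, neg_eq_iff_eq_neg.2 hl]

theorem coeff_stepEval_of_natDegree_lt {P : R[X]} {l : ℤ} (h : P.natDegree < l.natAbs) :
    (stepEval P).coeff l = 0 := by
  rw [coeff_stepEval h.le, coeff_eq_zero_of_natDegree_lt h]

end StepEvaluation

section Chebyshev

variable {R : Type*} [CommRing R]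

theorem isMonicOfDegree_succ_of_recurrence [Nontrivial R] {p : ℕ → R[X]}
    (h₀ : (p 0).natDegree = 0) (h₁ : IsMonicOfDegree (p 1) 1)
    (hp : ∀ n, p (n + 2) = X * p (n + 1) - p n) (n : ℕ) : IsMonicOfDegree (p (n + 1)) (n + 1) := by
  induction n using Nat.strong_induction_on with
  | _ n ih =>
    rcases n with _ | n
    · exact h₁
    · have hdeg : (p n).natDegree ≤ n := by
        rcases n with _ | n
        · exact h₀.le
        · exact (ih n (by omega)).natDegree_eq.le
      rw [hp, add_comm (n + 1)]
      exact ((isMonicOfDegree_X R).mul (ih n n.lt_succ_self)).sub (by omega)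

theorem isMonicOfDegree_chebyshevC [Nontrivial R] {n : ℕ} (hn : n ≠ 0) :
    IsMonicOfDegree (Chebyshev.C R n) n := by
  obtain ⟨n, rfl⟩ := Nat.exists_eq_succ_of_ne_zero hn
  refine isMonicOfDegree_succ_of_recurrence (p := fun n => Chebyshev.C R n) ?_ ?_
    (fun n => mod_cast Chebyshev.C_add_two R n) n
  · simp
  · simpa using isMonicOfDegree_X R

theorem isMonicOfDegree_chebyshevS [Nontrivial R] (n : ℕ) :
    IsMonicOfDegree (Chebyshev.S R n) n := by
  rcases n with _ | n
  · simp [isMonicOfDegree_zero_iff]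
  · refine isMonicOfDegree_succ_of_recurrence (p := fun n => Chebyshev.S R n) ?_ ?_
      (fun n => mod_cast Chebyshev.S_add_two R n) n
    · simp
    · simpa using isMonicOfDegree_X R

theorem isMonicOfDegree_chebyshevS_sub [Nontrivial R] (n : ℕ) :
    IsMonicOfDegree (Chebyshev.S R n - Chebyshev.S R (n - 1)) n := by
  rcases n with _ | n
  · simp [isMonicOfDegree_zero_iff]
  · refine isMonicOfDegree_succ_of_recurrence
      (p := fun n => Chebyshev.S R n - Chebyshev.S R (n - 1)) ?_ ?_ (fun n => ?_) n
    · simp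
    · simpa using isMonicOfDegree_X_sub_one (1 : R)
    · push_cast
      rw [Chebyshev.S_add_two, show (n + 2 - 1 : ℤ) = n + 1 by ring, Chebyshev.S_add_one,
        add_sub_cancel_right]
      ring

theorem eval_chebyshevS_sub_mul {x y : R} (hxy : x * y = 1) (a : ℕ) :
    (Chebyshev.S R a).eval (x + y) - x * (Chebyshev.S R (a - 1)).eval (x + y) = y ^ a := by
  induction a with
  | zero => simp
  | succ a ih =>
    rw [Nat.cast_succ, Chebyshev.S_add_one, add_sub_cancel_right, pow_succ, ← ih]
    simp only [eval_sub, eval_mul, eval_X]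
    linear_combination (Chebyshev.S R (a - 1)).eval (x + y) * hxy

theorem sub_mul_eval_chebyshevS {x y : R} (hxy : x * y = 1) (a : ℕ) :
    (x - y) * (Chebyshev.S R a).eval (x + y) = x ^ (a + 1) - y ^ (a + 1) := by
  have hx := eval_chebyshevS_sub_mul (mul_comm x y ▸ hxy) a
  rw [add_comm y x] at hx
  linear_combination x * hx - y * eval_chebyshevS_sub_mul hxy a

theorem one_add_mul_eval_chebyshevS_sub {x y : R} (hxy : x * y = 1) (a : ℕ) :
    (1 + x) * (Chebyshev.S R a - Chebyshev.S R (a - 1)).eval (x + y) = x ^ (a + 1) + y ^ a := by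
  have hx := eval_chebyshevS_sub_mul (mul_comm x y ▸ hxy) a
  rw [add_comm y x] at hx
  rw [eval_sub]
  linear_combination x * hx + eval_chebyshevS_sub_mul hxy a +
    (Chebyshev.S R (a - 1)).eval (x + y) * hxy

theorem eval_chebyshevC_add {x y : R} (hxy : x * y = 1) (n : ℕ) :
    (Chebyshev.C R n).eval (x + y) = x ^ n + y ^ n := by
  rw [← dickson_one_one_eq_chebyshev_C, dickson_one_one_eval_add_inv x y hxy]

end Chebyshev

section BlockBasis

variable (R : Type*) [CommRing R]

/-- The polynomial `U_{K,a}` with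
`U_{K,a}(z + 1 + z⁻¹) = (z^(K(a+1)) - z^(-K(a+1))) / (z^K - z^(-K))`. Its multiple by
`X - 3 = (z - 1)(1 - z⁻¹)` generates the `a`-th block of size `K - 1` in `blockBasis`. -/
noncomputable def stepU (K a : ℕ) : R[X] :=
  (Chebyshev.S R a).comp ((Chebyshev.C R K).comp (X - C 1))

/-- The polynomial `V_{K,a}` with `V_{K,a}(z + 1 + z⁻¹) = (z^(K(a+1)) + z^(-Ka)) / (z^K + 1)`. It is
orthogonal to all polynomials of degree below `K * a` for the functional
`P ↦ windowSum K (stepEval P)`. -/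
noncomputable def stepV (K a : ℕ) : R[X] :=
  (Chebyshev.S R a - Chebyshev.S R (a - 1)).comp ((Chebyshev.C R K).comp (X - C 1))

/-- A monic basis in which the Gram matrix of `P ↦ windowSum K (stepEval P)` is block triangular,
with diagonal blocks alternately of size `1`, from `stepV`, and of size `K - 1`, from the multiples
of `stepU`. -/
noncomputable def blockBasis (K i : ℕ) : R[X] :=
  if i % K = 0 then stepV R K (i / K) else (X - C 3) * stepU R K (i / K) * X ^ (i % K - 1)

/-- The entries of the Gram matrix of `P ↦ windowSum K (stepEval P)` in the basis `blockBasis`. -/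
noncomputable def blockGram (K i j : ℕ) : R :=
  windowSum K (stepEval (blockBasis R K i * blockBasis R K j))

variable {R}

theorem isMonicOfDegree_chebyshevC_comp [Nontrivial R] {K : ℕ} (hK : K ≠ 0) :
    IsMonicOfDegree ((Chebyshev.C R K).comp (X - C 1)) K := by
  simpa only [mul_one] using
    (isMonicOfDegree_chebyshevC hK).comp one_ne_zero (isMonicOfDegree_X_sub_one (1 : R))

theorem isMonicOfDegree_stepU [Nontrivial R] {K : ℕ} (hK : K ≠ 0) (a : ℕ) :
    IsMonicOfDegree (stepU R K a) (K * a) :=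
  mul_comm a K ▸ (isMonicOfDegree_chebyshevS a).comp hK (isMonicOfDegree_chebyshevC_comp hK)

theorem isMonicOfDegree_stepV [Nontrivial R] {K : ℕ} (hK : K ≠ 0) (a : ℕ) :
    IsMonicOfDegree (stepV R K a) (K * a) :=
  mul_comm a K ▸ (isMonicOfDegree_chebyshevS_sub a).comp hK (isMonicOfDegree_chebyshevC_comp hK)

theorem blockBasis_mul {K : ℕ} (hK : K ≠ 0) (a : ℕ) : blockBasis R K (K * a) = stepV R K a := by
  rw [blockBasis, Nat.mul_mod_right, if_pos rfl, Nat.mul_div_cancel_left _ (Nat.pos_of_ne_zero hK)]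

theorem blockBasis_mul_add (a : ℕ) {K s : ℕ} (hs : s + 1 < K) :
    blockBasis R K (K * a + (s + 1)) = (X - C 3) * stepU R K a * X ^ s := by
  rw [blockBasis, Nat.mul_add_mod, Nat.mod_eq_of_lt hs, if_neg s.succ_ne_zero,
    Nat.mul_add_div (by omega), Nat.div_eq_of_lt hs, add_zero, Nat.add_sub_cancel]

theorem exists_eq_mul_or_eq_mul_add {K : ℕ} (hK : K ≠ 0) (i : ℕ) :
    (∃ a, i = K * a) ∨ ∃ a s, s + 1 < K ∧ i = K * a + (s + 1) := by
  have hi := (Nat.div_add_mod i K).symm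
  have hlt := Nat.mod_lt i (Nat.pos_of_ne_zero hK)
  rcases h : i % K with _ | s
  · exact .inl ⟨i / K, by omega⟩
  · exact .inr ⟨i / K, s, by omega, by omega⟩

theorem isMonicOfDegree_blockBasis [Nontrivial R] {K : ℕ} (hK : K ≠ 0) (i : ℕ) :
    IsMonicOfDegree (blockBasis R K i) i := by
  rcases exists_eq_mul_or_eq_mul_add hK i with ⟨a, rfl⟩ | ⟨a, s, hs, rfl⟩
  · rw [blockBasis_mul hK]
    exact isMonicOfDegree_stepV hK a
  · rw [blockBasis_mul_add a hs, show K * a + (s + 1) = 1 + K * a + s by ring]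
    exact ((isMonicOfDegree_X_sub_one 3).mul (isMonicOfDegree_stepU hK a)).mul
      (isMonicOfDegree_X_pow R s)

theorem T_mul_T_neg (n : ℤ) : (T n * T (-n) : R[T;T⁻¹]) = 1 := by
  rw [← LaurentPolynomial.T_add, add_neg_cancel, LaurentPolynomial.T_zero]

theorem stepEval_chebyshevC_comp (K : ℕ) :
    stepEval ((Chebyshev.C R K).comp (X - C 1)) = T K + T (-K) := by
  have hX : stepEval (X - C 1 : R[X]) = T 1 + T (-1) := by
    rw [C_1, map_sub, stepEval_X, map_one, stepSum]
    ring
  rw [stepEval, aeval_comp, ← stepEval, hX, Chebyshev.aeval_C, eval_chebyshevC_add (T_mul_T_neg 1),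
    LaurentPolynomial.T_pow, LaurentPolynomial.T_pow, mul_one, mul_neg_one]

theorem T_sub_T_neg_mul_stepEval_stepU (K a : ℕ) :
    (T K - T (-K)) * stepEval (stepU R K a) = T (K * (a + 1)) - T (-(K * (a + 1))) := by
  rw [stepU, stepEval, aeval_comp, ← stepEval, stepEval_chebyshevC_comp, Chebyshev.aeval_S,
    sub_mul_eval_chebyshevS (T_mul_T_neg _), LaurentPolynomial.T_pow, LaurentPolynomial.T_pow]
  push_cast
  ring_nf

theorem one_add_T_mul_stepEval_stepV (K a : ℕ) :
    (1 + T K) * stepEval (stepV R K a) = T (K * (a + 1)) + T (-(K * a)) := by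
  rw [stepV, stepEval, aeval_comp, ← stepEval, stepEval_chebyshevC_comp, map_sub,
    Chebyshev.aeval_S, Chebyshev.aeval_S, ← eval_sub,
    one_add_mul_eval_chebyshevS_sub (T_mul_T_neg _), LaurentPolynomial.T_pow,
    LaurentPolynomial.T_pow]
  push_cast
  ring_nf

theorem stepEval_X_sub_three : stepEval (X - C 3 : R[X]) = (T 1 - 1) * (1 - T (-1)) := by
  rw [map_sub, stepEval_X, show (C 3 : R[X]) = 3 from rfl, map_ofNat, stepSum]
  linear_combination T_mul_T_neg (R := R) 1

theorem windowSum_stepV_mul {K a : ℕ} (hK : K ≠ 0) {P : R[X]} (hP : P.natDegree ≤ K * a) :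
    windowSum K (stepEval (stepV R K a * P)) = P.coeff (K * a) := by
  obtain ⟨k, rfl⟩ := Nat.exists_eq_succ_of_ne_zero hK
  zify at hP
  have hcoeff (t : ℕ) : ((1 + T (k + 1 : ℕ)) * stepEval (stepV R (k + 1) a * P)).coeff (t + 1) =
      (stepEval P).coeff (t - k - (k + 1) * a) + (stepEval P).coeff (t + 1 + (k + 1) * a) := by
    rw [map_mul, ← mul_assoc, one_add_T_mul_stepEval_stepV, add_mul, AddMonoidAlgebra.coeff_add,
      Finsupp.add_apply, coeff_T_mul, coeff_T_mul]
    push_cast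
    ring_nf
  have hright (t : ℕ) : (stepEval P).coeff (t + 1 + (k + 1) * a) = 0 :=
    coeff_stepEval_of_natDegree_lt (by zify; rw [abs_of_nonneg (by positivity)]; omega)
  have hleft : ∀ t ∈ range k, (stepEval P).coeff (t - k - (k + 1) * a) = 0 := fun t ht =>
    coeff_stepEval_of_natDegree_lt (by
      have := mem_range.1 ht
      omega)
  rw [windowSum_eq_sum_coeff_one_add_T_mul]
  simp only [hcoeff, hright, add_zero]
  rw [sum_range_succ, sum_eq_zero hleft, zero_add, sub_self, zero_sub, coeff_stepEval_neg]
  exact_mod_cast coeff_stepEval_natCast (by exact_mod_cast hP)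

theorem windowSum_stepU_mul {K a : ℕ} {P : R[X]} (hP : P.natDegree < K * (a + 1)) :
    windowSum K (stepEval ((X - C 3) * stepU R K a * P)) = -P.coeff (K * (a + 1) - 1) := by
  obtain ⟨N, hN⟩ : ∃ N, K * (a + 1) = N + 1 := Nat.exists_eq_succ_of_ne_zero (by omega)
  have hNz : (K * (a + 1) : ℤ) = N + 1 := mod_cast hN
  rw [map_mul stepEval, map_mul stepEval, stepEval_X_sub_three, mul_assoc, mul_assoc,
    windowSum_T_one_sub_one_mul,
    show (T K - T (-K)) * ((1 - T (-1)) * (stepEval (stepU R K a) * stepEval P)) =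
      (T K - T (-K)) * stepEval (stepU R K a) * (stepEval P - T (-1) * stepEval P) by ring,
    T_sub_T_neg_mul_stepEval_stepU, hNz, hN, Nat.add_sub_cancel]
  have hvanish {l : ℤ} (hl : N < l.natAbs) : (stepEval P).coeff l = 0 :=
    coeff_stepEval_of_natDegree_lt (by omega)
  have htop : (stepEval P).coeff (-N) = P.coeff N := by
    rw [coeff_stepEval_neg, coeff_stepEval_natCast (by omega)]
  simp only [sub_mul, AddMonoidAlgebra.coeff_sub, Finsupp.sub_apply, coeff_T_mul]
  rw [hvanish (l := 0 - (N + 1)) (by omega), hvanish (l := 0 - -(N + 1)) (by omega),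
    hvanish (l := 0 - -(N + 1) - -1) (by omega), show (0 - (N + 1) - -1 : ℤ) = -N by ring, htop]
  ring

theorem coeff_of_isMonicOfDegree_of_le {p : R[X]} {j n : ℕ} (hp : IsMonicOfDegree p j)
    (h : j ≤ n) : p.coeff n = if j = n then 1 else 0 := by
  split_ifs with hjn
  · rw [← hjn, ← hp.leadingCoeff_eq, leadingCoeff, hp.natDegree_eq]
  · exact coeff_eq_zero_of_natDegree_lt (by rw [hp.natDegree_eq]; omega)

end BlockBasis

section BlockGram

variable {R : Type*} [CommRing R] [Nontrivial R] {K : ℕ}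

theorem blockGram_mul_left (hK : K ≠ 0) {a j : ℕ} (hj : j ≤ K * a) :
    blockGram R K (K * a) j = if j = K * a then 1 else 0 := by
  have hb := isMonicOfDegree_blockBasis (R := R) hK j
  rw [blockGram, blockBasis_mul hK, windowSum_stepV_mul hK (hb.natDegree_eq.trans_le hj),
    coeff_of_isMonicOfDegree_of_le hb hj]

theorem blockGram_mul_add_left {a s j : ℕ} (hs : s + 1 < K) (hj : s + j + 1 ≤ K * (a + 1)) :
    blockGram R K (K * a + (s + 1)) j = if s + j + 1 = K * (a + 1) then -1 else 0 := by
  have hb := (isMonicOfDegree_X_pow R s).mul (isMonicOfDegree_blockBasis (by omega : K ≠ 0) j)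
  rw [blockGram, blockBasis_mul_add a hs, mul_assoc,
    windowSum_stepU_mul (hb.natDegree_eq.trans_lt hj),
    coeff_of_isMonicOfDegree_of_le hb (by omega), apply_ite Neg.neg, neg_zero]
  exact if_congr (by omega) rfl rfl

theorem blockGram_eq_zero (hK : K ≠ 0) {a i j : ℕ} (hi : K * a ≤ i) (hj : j ≤ K * a)
    (hji : j < i) : blockGram R K i j = 0 := by
  rcases exists_eq_mul_or_eq_mul_add hK i with ⟨a', rfl⟩ | ⟨a', s, hs, rfl⟩
  · rw [blockGram_mul_left hK hji.le, if_neg hji.ne]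
  · have ha : a ≤ a' := by
      by_contra! ha
      have := Nat.mul_le_mul_left K (Nat.succ_le_of_lt ha)
      rw [Nat.mul_succ] at this
      omega
    have hja := hj.trans (Nat.mul_le_mul_left K ha)
    rw [blockGram_mul_add_left hs (by rw [Nat.mul_succ]; omega),
      if_neg (by rw [Nat.mul_succ]; omega)]

theorem det_blockGram_mul_add_one (hK : K ≠ 0) (a : ℕ) :
    (of fun i j : Fin (K * a + 1) => blockGram R K i j).det =
      (of fun i j : Fin (K * a) => blockGram R K i j).det := by
  rw [det_eq_mul_of_lower_left_eq_zero, det_fin_one]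
  · have hone : blockGram R K (K * a) (K * a) = 1 := by
      rw [blockGram_mul_left hK le_rfl, if_pos rfl]
    exact (congrArg _ hone).trans (mul_one _)
  · exact fun i j => blockGram_eq_zero hK (Nat.le_add_right _ _) j.2.le (by simp)

theorem det_blockGram_antitriangular_block (k a : ℕ) :
    (of fun i j : Fin k => blockGram R (k + 1) ((k + 1) * a + 1 + i) ((k + 1) * a + 1 + j)).det =
      (-1) ^ (k + 1).choose 2 := by
  have hentry (i j : Fin k) (hij : j ≤ i.rev) :
      blockGram R (k + 1) ((k + 1) * a + 1 + i) ((k + 1) * a + 1 + j) =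
        if j = i.rev then -1 else 0 := by
    have hle : (j : ℕ) + i + 1 ≤ k := by
      have := Fin.le_def.1 hij
      rw [Fin.val_rev] at this
      omega
    rw [add_assoc, add_comm 1 (i : ℕ),
      blockGram_mul_add_left (by omega) (by rw [mul_add_one]; omega)]
    refine if_congr ?_ rfl rfl
    rw [Fin.ext_iff, Fin.val_rev, mul_add_one]
    omega
  rw [det_of_antitriangular (of fun i j : Fin k => blockGram R (k + 1) _ _) fun i j hij =>
    (hentry i j hij.le).trans (if_neg hij.ne)]
  simp only [of_apply, hentry _ _ le_rfl, if_true, prod_const, card_univ, Fintype.card_fin]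
  rw [← pow_add, Nat.choose_succ_succ' k 1, Nat.choose_one_right, add_comm]

theorem det_blockGram_mul (k a : ℕ) :
    (of fun i j : Fin ((k + 1) * a) => blockGram R (k + 1) i j).det =
      (-1) ^ (a * (k + 1).choose 2) := by
  induction a with
  | zero => simp
  | succ a ih =>
    rw [show (k + 1) * (a + 1) = (k + 1) * a + 1 + k by ring, det_eq_mul_of_lower_left_eq_zero,
      add_one_mul a, pow_add, ← ih, ← det_blockGram_mul_add_one k.succ_ne_zero,
      ← det_blockGram_antitriangular_block k a]
    · rfl
    · exact fun i j => blockGram_eq_zero k.succ_ne_zero (a := a) (by simp; omega)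
        (Nat.lt_succ_iff.1 j.2) (by simp; omega)

theorem det_blockGram_mul_add_eq_zero (a : ℕ) {r : ℕ} (hr : 1 < r) (hrK : r < K) :
    (of fun i j : Fin (K * a + r) => blockGram R K i j).det = 0 := by
  refine det_eq_zero_of_row_eq_zero ⟨K * a + 1, by omega⟩ fun j => ?_
  exact (blockGram_mul_add_left (s := 0) (by omega) (by rw [mul_add_one]; omega)).trans
    (if_neg (by rw [mul_add_one]; omega))

theorem det_motzkinPrefix_eq_det_blockGram (n k : ℕ) :
    (of fun i j : Fin n => (motzkinPrefix ((i : ℕ) + (j : ℕ)) k : R)).det =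
      (of fun i j : Fin n => blockGram R (k + 1) i j).det := by
  simp only [motzkinPrefix_eq_windowSum, ← stepEval_X, ← map_pow]
  exact (det_gram_of_isMonicOfDegree ((windowSum (k + 1)).comp stepEval.toLinearMap)
    (isMonicOfDegree_blockBasis k.succ_ne_zero) n).symm

end BlockGram

theorem corollary15 (n k : ℕ) (hn : 0 < n) :
    (Matrix.of fun i j : Fin n => (motzkinPrefix ((i : ℕ) + (j : ℕ)) k : ℤ)).det =
        (Matrix.of fun i j : Fin n => (trinomialSum ((i : ℕ) + (j : ℕ)) k : ℤ)).det ∧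
      (∀ n₁ : ℕ, n = (k + 1) * n₁ ∨ n = (k + 1) * n₁ + 1 →
        (Matrix.of fun i j : Fin n => (motzkinPrefix ((i : ℕ) + (j : ℕ)) k : ℤ)).det =
          (-1) ^ (n₁ * (k + 1).choose 2)) ∧
      (¬ n ≡ 0 [MOD k + 1] → ¬ n ≡ 1 [MOD k + 1] →
        (Matrix.of fun i j : Fin n => (motzkinPrefix ((i : ℕ) + (j : ℕ)) k : ℤ)).det = 0) ∧
      (Matrix.of fun i j : Fin n => (motzkinPrefix ((i : ℕ) + (j : ℕ)) 0 : ℤ)).det = 1 := by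
  refine ⟨?_, ?_, fun h₀ h₁ => ?_, ?_⟩
  · simp only [motzkinPrefix_eq_windowSum, trinomialSum_eq_windowSum]
  · rintro a (rfl | rfl) <;> rw [det_motzkinPrefix_eq_det_blockGram]
    · exact det_blockGram_mul k a
    · exact (det_blockGram_mul_add_one k.succ_ne_zero a).trans (det_blockGram_mul k a)
  · obtain ⟨a, r, hr, rfl⟩ : ∃ a r, r < k + 1 ∧ n = (k + 1) * a + r :=
      ⟨n / (k + 1), n % (k + 1), Nat.mod_lt _ k.succ_pos, (Nat.div_add_mod _ _).symm⟩
    have hr₀ : r ≠ 0 := fun h => h₀ (by simp [Nat.ModEq, h])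
    have hr₁ : r ≠ 1 := fun h => h₁ (by simp [Nat.ModEq, h])
    rw [det_motzkinPrefix_eq_det_blockGram]
    exact det_blockGram_mul_add_eq_zero a (by omega) hr
  · obtain ⟨n₁, rfl⟩ : ∃ n₁, n = (0 + 1) * n₁ := ⟨n, by ring⟩
    rw [det_motzkinPrefix_eq_det_blockGram, det_blockGram_mul]
    simp
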